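/- **Setting.** For $1\le k\le n$ let $\mathbb V_{n,k}=\{A\in\mathbb R^{n\times k}: A^{\mathsf T}A=I_k\}$ be the Stiefel manifold with its Haar probability measure (the law of the first $k$ columns of a Haar-distributed orthogonal $n\times n$ matrix). Let $(k_n)_{n\ge1}$ be integers with $1\le k_n\le n$, let $\sigma_n$ be the Haar probability measure on $\mathbb V_{n,k_n}$, and let $\sigma$ be any probability measure on $\mathbb V=\prod_{n\ge 1}\mathbb V_{n,k_n}$ whose $n$-th marginal is $\sigma_n$ for every $n$. For $a\in\mathbb V_{n,k_n}$ let $a_i\in\mathbb R^{k_n}$ denote its $i$-th row. Let $X_1,X_2,\dots$ be i.i.d. real random variables, let $\eta:\mathbb R\to[0,\infty)$ be continuous, and let $$\overline\Lambda(t_1,t_2)=\log\mathbb E\big[\exp(t_1X_1+t_2\eta(X_1))\big]\in\mathbb R\cup\{\infty\}.$$ Assume: 1. $\mathbb E[X_1]=0$, and there is $C_2>0$ with $\mathbb P(|X_1|\ge s)\le 2\exp(-s^2/C_2^2)$ for all $s\ge0$. 2. $0<T\le\infty$; $\overline\Lambda$ is finite on $\mathbb R\times(-\infty,T)$; its partial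 derivatives $\partial_1^\alpha\partial_2^\beta\overline\Lambda$ with $\alpha+\beta\le2$ exist on $\mathbb R\times(-\infty,T)$; and $\overline\Lambda$ is essentially smooth, that is, the interior $U$ of $\{\overline\Lambda<\infty\}$ is non-empty, $\overline\Lambda$ is differentiable on $U$, and $|\nabla\overline\Lambda(\lambda_m)|\to\infty$ whenever $\lambda_m\in U$ converges to a boundary point of $U$. 3. There is a continuous $\widetilde C:(-\infty,T)\to[0,\infty)$ with $|\partial_1^\alpha\partial_2^\beta\overline\Lambda(t_1,t_2)|\le\widetilde C(t_2)\,(1+|t_1|^{2-\alpha})$ for all $t_1\in\mathbb R$, $t_2<T$ and integers $\alpha,\beta\ge0$ with $\alpha+\beta\le2$. Let $D\in(0,\infty)$, let $(d_n)_{n\ge1}$ be positive integers with $\limsup_{n\to\infty}\frac1n\log d_n=0$, and for every $n$ let $v^{(n,1)},\dots,v^{(n,d_n)}\in\mathbb R^{k_n}$ be deterministic vectors with $\|v^{(n,j)}\|_2=D$ for all $j$. Let $g$ be a standard Gaussian random variable. **Lemma.** For every $c\in(-\infty,T)$, the variable $\overline\Lambda(Dg,c)$ is integrable and, for $\sigma$-almost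 every $\mathbf a=(a^{(n)})_{n\ge1}\in\mathbb V$, $$\lim_{n\to\infty}\ \sup_{1\le j\le d_n}\left|\frac1n\sum_{i=1}^n\overline\Lambda\big(\langle v^{(n,j)},\sqrt n\,a_i^{(n)}\rangle,c\big)-\mathbb E\big[\overline\Lambda(Dg,c)\big]\right|=0 .$$ Moreover, let $\mu^{(n,j)}_{\mathbf a}=\frac1n\sum_{i=1}^n\delta_{\langle v^{(n,j)},\sqrt n a_i^{(n)}\rangle}$ be the empirical measures of the projected rows. For every differentiable $H:\mathbb R\to\mathbb R$ such that, for some constant $C$, $|H(t)|^2\le C(1+t^2)$ and $|H'(t)|^2\le C(1+|t|)$ for all $t\in\mathbb R$, the variable $H(Dg)$ is integrable and, for $\sigma$-almost every $\mathbf a\in\mathbb V$, $$\lim_{n\to\infty}\ \sup_{1\le j\le d_n}\left|\int H\,d\mu^{(n,j)}_{\mathbf a}-\mathbb E[H(Dg)]\right|=0 .$$ -/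

import Mathlib

open MeasureTheory ProbabilityTheory Filter Topology
open scoped ENNReal Matrix

noncomputable section

namespace StiefelLLN

/-! ### The Stiefel manifold and its Haar measure -/

/-- The Stiefel manifold `{A ∈ ℝ^{n × k} : Aᵀ A = I_k}` of orthonormal `k`-frames in `ℝⁿ`. -/
def stiefel (n k : ℕ) : Set (Matrix (Fin n) (Fin k) ℝ) := {A | Aᵀ * A = 1}

theorem mem_stiefel {n k : ℕ} {A : Matrix (Fin n) (Fin k) ℝ} :
    A ∈ stiefel n k ↔ Aᵀ * A = 1 := Iff.rfl

instance instMeasurableSpaceStiefel (n k : ℕ) : MeasurableSpace (stiefel n k) := borel _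

instance instBorelSpaceStiefel (n k : ℕ) : BorelSpace (stiefel n k) := ⟨rfl⟩

/-- The orthogonal group `O(n)`. -/
abbrev orthoGroup (n : ℕ) := Matrix.orthogonalGroup (Fin n) ℝ

instance instMeasurableSpaceOrthoGroup (n : ℕ) : MeasurableSpace (orthoGroup n) := borel _

instance instBorelSpaceOrthoGroup (n : ℕ) : BorelSpace (orthoGroup n) := ⟨rfl⟩

instance instCompactSpaceOrthoGroup (n : ℕ) : CompactSpace (orthoGroup n) := by
  refine (isCompact_iff_compactSpace (s := ((Matrix.orthogonalGroup (Fin n) ℝ :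
    Submonoid (Matrix (Fin n) (Fin n) ℝ)) : Set (Matrix (Fin n) (Fin n) ℝ)))).1 ?_
  have hK : IsCompact (Set.univ.pi fun _ : Fin n => Set.univ.pi fun _ : Fin n =>
      Set.Icc (-1 : ℝ) 1) :=
    isCompact_univ_pi fun _ => isCompact_univ_pi fun _ => isCompact_Icc
  refine IsCompact.of_isClosed_subset (X := Matrix (Fin n) (Fin n) ℝ) hK ?_ ?_
  · have : ((Matrix.orthogonalGroup (Fin n) ℝ : Submonoid _) : Set (Matrix (Fin n) (Fin n) ℝ))
        = {A | A * star A = 1} := by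
      ext A
      exact Matrix.mem_orthogonalGroup_iff _ _
    rw [this]
    exact isClosed_eq (continuous_id.mul continuous_star) continuous_const
  · intro U hU i _ j _
    have := entry_norm_bound_of_unitary (𝕜 := ℝ) hU i j
    rw [Real.norm_eq_abs] at this
    exact abs_le.1 this

/-- The Haar probability measure on the compact group `O(n)`. -/
def orthoHaar (n : ℕ) : Measure (orthoGroup n) := Measure.haarMeasure ⊤

instance instIsProbabilityMeasureOrthoHaar (n : ℕ) : IsProbabilityMeasure (orthoHaar n) :=
  ⟨by simpa [orthoHaar] using
    (Measure.haarMeasure_self (K₀ := (⊤ : TopologicalSpace.PositiveCompacts (orthoGroup n))))⟩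

/-- The frame formed by the first `k` columns of an orthogonal matrix. -/
def firstColumns {n k : ℕ} (h : k ≤ n) (Q : orthoGroup n) : stiefel n k :=
  ⟨(Q : Matrix (Fin n) (Fin n) ℝ).submatrix id (Fin.castLE h), by
    have hQ : (Q : Matrix (Fin n) (Fin n) ℝ)ᵀ * (Q : Matrix (Fin n) (Fin n) ℝ) = 1 :=
      (Matrix.mem_orthogonalGroup_iff' _ _).1 Q.2
    rw [mem_stiefel, Matrix.transpose_submatrix,
      ← Matrix.submatrix_mul _ _ _ _ _ Function.bijective_id, hQ]
    exact Matrix.submatrix_one _ (Fin.castLE_injective h)⟩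

/-- The action of `O(n)` on frames by left multiplication. -/
def rotate {n k : ℕ} (Q : orthoGroup n) (A : stiefel n k) : stiefel n k :=
  ⟨(Q : Matrix (Fin n) (Fin n) ℝ) * (A : Matrix (Fin n) (Fin k) ℝ), by
    have hQ : (Q : Matrix (Fin n) (Fin n) ℝ)ᵀ * (Q : Matrix (Fin n) (Fin n) ℝ) = 1 :=
      (Matrix.mem_orthogonalGroup_iff' _ _).1 Q.2
    have hA : (A : Matrix (Fin n) (Fin k) ℝ)ᵀ * (A : Matrix (Fin n) (Fin k) ℝ) = 1 := A.2
    rw [mem_stiefel, Matrix.transpose_mul, Matrix.mul_assoc, ← Matrix.mul_assoc _ _ A.1, hQ, Matrix.one_mul, hA]⟩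

theorem continuous_firstColumns {n k : ℕ} (h : k ≤ n) : Continuous (firstColumns h) :=
  Continuous.subtype_mk (continuous_subtype_val.matrix_submatrix _ _) _

theorem continuous_rotate {n k : ℕ} (Q : orthoGroup n) :
    Continuous (rotate Q : stiefel n k → stiefel n k) :=
  Continuous.subtype_mk (continuous_const.matrix_mul continuous_subtype_val) _

/-- The Haar probability measure on the Stiefel manifold: the law of the first `k` columns of a
Haar-distributed orthogonal matrix. It is the `O(n)`-invariant probability measure. -/
def stiefelHaar {n k : ℕ} (h : k ≤ n) : Measure (stiefel n k) :=
  (orthoHaar n).map (firstColumns h)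

instance instIsProbabilityMeasureStiefelHaar {n k : ℕ} (h : k ≤ n) :
    IsProbabilityMeasure (stiefelHaar h) :=
  Measure.isProbabilityMeasure_map (continuous_firstColumns h).measurable.aemeasurable

/-- The Haar measure on the Stiefel manifold is invariant under rotations. -/
theorem map_rotate_stiefelHaar {n k : ℕ} (h : k ≤ n) (Q : orthoGroup n) :
    (stiefelHaar h).map (rotate Q) = stiefelHaar h := by
  unfold stiefelHaar
  rw [Measure.map_map (continuous_rotate Q).measurable (continuous_firstColumns h).measurable]
  have hc : (rotate Q : stiefel n k → stiefel n k) ∘ firstColumns h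
      = firstColumns h ∘ fun R => Q * R := by
    funext R
    apply Subtype.ext
    ext i j
    simp [rotate, firstColumns, Matrix.mul_apply]
  rw [hc, ← Measure.map_map (continuous_firstColumns h).measurable
    (continuous_const_mul Q).measurable]
  congr 1
  exact map_mul_left_eq_self (Measure.haarMeasure ⊤) Q

/-! ### The log-moment generating function and the standing assumptions -/

/-- The log-moment generating function `log E[exp (t₁ Z + t₂ η(Z))]` of `(Z, η(Z))`, with values
in the extended reals. -/
def logMGF {Ω : Type*} [MeasurableSpace Ω] (P : Measure Ω) (Z : Ω → ℝ) (η : ℝ → ℝ)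
    (t₁ t₂ : ℝ) : EReal :=
  ENNReal.log (∫⁻ ω, ENNReal.ofReal (Real.exp (t₁ * Z ω + t₂ * η (Z ω))) ∂P)

/-- The partial derivative `∂₁^α ∂₂^β L (t₁, t₂)`. -/
def partialDeriv (L : ℝ → ℝ → ℝ) (α β : ℕ) (t₁ t₂ : ℝ) : ℝ :=
  iteratedDeriv α (fun s => iteratedDeriv β (fun t => L s t) t₂) t₁

/-- Essential smoothness of a convex function `f` with values in `(-∞, ∞]`. -/
structure EssentiallySmooth {E : Type*} [NormedAddCommGroup E] [NormedSpace ℝ E]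
    (f : E → EReal) : Prop where
  nonempty : (interior {x | f x < ⊤}).Nonempty
  differentiable : ∀ x ∈ interior {x | f x < ⊤}, DifferentiableAt ℝ (fun y => (f y).toReal) x
  steep : ∀ (u : ℕ → E) (x : E), (∀ m, u m ∈ interior {x | f x < ⊤}) →
    x ∈ frontier (interior {x | f x < ⊤}) → Tendsto u atTop (𝓝 x) →
    Tendsto (fun m => ‖fderiv ℝ (fun y => (f y).toReal) (u m)‖) atTop atTop

/-- `Z` has mean zero and a sub-Gaussian tail. -/
structure CenteredSubGaussian {Ω : Type*} [MeasurableSpace Ω] (P : Measure Ω) (Z : Ω → ℝ) :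
    Prop where
  integrable : Integrable Z P
  mean_zero : ∫ ω, Z ω ∂P = 0
  tail : ∃ C₂ : ℝ, 0 < C₂ ∧
    ∀ s : ℝ, 0 ≤ s → P.real {ω | s ≤ |Z ω|} ≤ 2 * Real.exp (-(s ^ 2) / C₂ ^ 2)

/-- Regularity of the log-moment generating function `Λ` on `ℝ × (-∞, T)`: it is finite there, it
is essentially smooth, and its partial derivatives up to order two exist there. -/
structure RegularLogMGF (Λ : ℝ → ℝ → EReal) (T : EReal) : Prop where
  T_pos : 0 < T
  finite : ∀ t₁ t₂ : ℝ, (t₂ : EReal) < T → Λ t₁ t₂ ≠ ⊤ ∧ Λ t₁ t₂ ≠ ⊥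
  essentiallySmooth : EssentiallySmooth fun p : ℝ × ℝ => Λ p.1 p.2
  exists_partial₁ : ∀ α β : ℕ, α + 1 + β ≤ 2 → ∀ t₁ t₂ : ℝ, (t₂ : EReal) < T →
    DifferentiableAt ℝ (fun s => partialDeriv (fun x y => (Λ x y).toReal) α β s t₂) t₁
  exists_partial₂ : ∀ β : ℕ, β + 1 ≤ 2 → ∀ t₁ t₂ : ℝ, (t₂ : EReal) < T →
    DifferentiableAt ℝ (fun t => partialDeriv (fun x y => (Λ x y).toReal) 0 β t₁ t) t₂

/-- Growth bounds for `Λ` and its partial derivatives up to order two on `ℝ × (-∞, T)`. -/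
def GrowthLogMGF (Λ : ℝ → ℝ → EReal) (T : EReal) : Prop :=
  ∃ C : ℝ → ℝ, ContinuousOn C {t | (t : EReal) < T} ∧ (∀ t : ℝ, (t : EReal) < T → 0 ≤ C t) ∧
    ∀ α β : ℕ, α + β ≤ 2 → ∀ t₁ t₂ : ℝ, (t₂ : EReal) < T →
      |partialDeriv (fun x y => (Λ x y).toReal) α β t₁ t₂| ≤ C t₂ * (1 + |t₁| ^ (2 - α))

/-! ### Averages over the rows of a frame -/

/-- The scalar product `⟨v, √n a_i⟩`, where `a_i` is the `i`-th row of `a`. -/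
def rowProj {n k : ℕ} (v : EuclideanSpace ℝ (Fin k)) (a : stiefel n k) (i : Fin n) : ℝ :=
  inner ℝ v (√(n : ℝ) • WithLp.toLp 2 ((a : Matrix (Fin n) (Fin k) ℝ) i))

/-- `F_n(v, a, c) = (1/n) ∑ᵢ Λ(⟨v, √n a_i⟩, c)`. -/
def rowAverage {n k : ℕ} (Λ : ℝ → ℝ → EReal) (v : EuclideanSpace ℝ (Fin k)) (a : stiefel n k)
    (c : ℝ) : ℝ :=
  (1 / (n : ℝ)) * ∑ i, (Λ (rowProj v a i) c).toReal

/-- The empirical measure `(1/n) ∑ᵢ δ_{⟨v, √n a_i⟩}`. -/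
def rowEmpirical {n k : ℕ} (v : EuclideanSpace ℝ (Fin k)) (a : stiefel n k) : Measure ℝ :=
  (n : ℝ≥0∞)⁻¹ • ∑ i, Measure.dirac (rowProj v a i)

end StiefelLLN

end

open StiefelLLN

/-! For fixed `v` of norm `D` and a Haar frame `A`, the vector `A v` is uniform on the sphere of
radius `D`, so it has the law of `D g / ‖g‖` with `g` standard Gaussian in `ℝⁿ`
(`stiefelHaar_mulVecLp`). The projected rows are therefore jointly distributed as `r D gᵢ`, with the
common random factor `r = √n / ‖g‖`.

Let `G` have a Lipschitz constant growing at most linearly. Then `G` grows at most quadratically, so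
`G (D gᵢ)` has exponential moments near `0`, and Chernoff's bound makes both `(1/n) ∑ G (D gᵢ)` and
`‖g‖² / n` concentrate exponentially fast. Replacing `r` by `1` costs at most a multiple of `|r - 1|
(1 + ‖g‖² / n)`. This gives a deviation bound `4 exp (-c n)` with `c` independent of `k` and `v`
(`exists_stiefelHaar_deviation_le`).

A union bound over the `exp (o(n))` vectors and Borel–Cantelli finish the proof; only the marginals
of `σ` enter. Both `Λ(·, c)` and `H` are such functions `G`, by their derivative bounds. -/

/-! ### The law of a Haar frame applied to a fixed vector -/

/-- The vector `A v` in Euclidean space. -/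
noncomputable def mulVecLp {n k : ℕ} (A : Matrix (Fin n) (Fin k) ℝ)
    (v : EuclideanSpace ℝ (Fin k)) : EuclideanSpace ℝ (Fin n) :=
  WithLp.toLp 2 (A *ᵥ v.ofLp)

theorem norm_mulVecLp {n k : ℕ} {A : Matrix (Fin n) (Fin k) ℝ} (hA : Aᵀ * A = 1)
    (v : EuclideanSpace ℝ (Fin k)) : ‖mulVecLp A v‖ = ‖v‖ := by
  have h : ‖mulVecLp A v‖ ^ 2 = ‖v‖ ^ 2 := by
    rw [← real_inner_self_eq_norm_sq, ← real_inner_self_eq_norm_sq]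
    simp only [mulVecLp, EuclideanSpace.inner_eq_star_dotProduct, star_trivial]
    rw [Matrix.dotProduct_mulVec, ← Matrix.mulVec_transpose, Matrix.mulVec_mulVec, hA,
      Matrix.one_mulVec]
  exact (pow_left_inj₀ (norm_nonneg _) (norm_nonneg _) two_ne_zero).1 h

theorem mulVecLp_mul {m n k : ℕ} (A : Matrix (Fin m) (Fin n) ℝ) (B : Matrix (Fin n) (Fin k) ℝ)
    (v : EuclideanSpace ℝ (Fin k)) : mulVecLp (A * B) v = mulVecLp A (mulVecLp B v) := by
  simp [mulVecLp, Matrix.mulVec_mulVec]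

theorem continuous_mulVecLp (n k : ℕ) :
    Continuous fun p : Matrix (Fin n) (Fin k) ℝ × EuclideanSpace ℝ (Fin k) =>
      mulVecLp p.1 p.2 := by
  unfold mulVecLp
  fun_prop

theorem orthoGroup_transpose_mul {n : ℕ} (Q : orthoGroup n) :
    (Q : Matrix (Fin n) (Fin n) ℝ)ᵀ * (Q : Matrix (Fin n) (Fin n) ℝ) = 1 :=
  (Matrix.mem_orthogonalGroup_iff' _ _).1 Q.2

/-- The orthogonal group acts transitively on spheres. -/
theorem exists_orthoGroup_mulVecLp_eq {n : ℕ} {x y : EuclideanSpace ℝ (Fin n)}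
    (h : ‖x‖ = ‖y‖) : ∃ R : orthoGroup n, mulVecLp (R : Matrix (Fin n) (Fin n) ℝ) x = y := by
  -- Reflection in the hyperplane orthogonal to `x - y` exchanges two vectors of equal norm.
  let f := (ℝ ∙ (x - y))ᗮ.reflection
  let b := EuclideanSpace.basisFun (Fin n) ℝ
  refine ⟨⟨LinearMap.toMatrix b.toBasis b.toBasis f.toLinearEquiv.toLinearMap,
    f.toMatrix_mem_unitaryGroup b b⟩, ?_⟩
  have hf : f x = y := Submodule.reflection_sub h
  rw [← hf]
  have hrepr : ∀ z : EuclideanSpace ℝ (Fin n), ⇑(b.toBasis.repr z) = z.ofLp := fun z => by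
    ext i
    simp [b]
  have key := LinearMap.toMatrix_mulVec_repr b.toBasis b.toBasis f.toLinearEquiv.toLinearMap x
  rw [hrepr, hrepr] at key
  ext i
  exact congrFun key i

/-- A right translate of Haar measure is again a left-invariant probability measure, so uniqueness
applies. -/
theorem map_mul_right_orthoHaar {n : ℕ} (R : orthoGroup n) :
    (orthoHaar n).map (· * R) = orthoHaar n := by
  have : (orthoHaar n).IsHaarMeasure := by unfold orthoHaar; infer_instance
  have : IsProbabilityMeasure ((orthoHaar n).map (· * R)) :=
    Measure.isProbabilityMeasure_map (continuous_mul_const R).measurable.aemeasurable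
  exact Measure.isHaarMeasure_eq_of_isProbabilityMeasure _ _

theorem orthoHaar_orbit_eq {n : ℕ} {x y : EuclideanSpace ℝ (Fin n)} (h : ‖x‖ = ‖y‖)
    {B : Set (EuclideanSpace ℝ (Fin n))} (hB : MeasurableSet B) :
    orthoHaar n {Q | mulVecLp (Q : Matrix (Fin n) (Fin n) ℝ) x ∈ B}
      = orthoHaar n {Q | mulVecLp (Q : Matrix (Fin n) (Fin n) ℝ) y ∈ B} := by
  obtain ⟨R, hR⟩ := exists_orthoGroup_mulVecLp_eq h.symm
  have hc : Continuous fun Q : orthoGroup n => mulVecLp (Q : Matrix (Fin n) (Fin n) ℝ) y :=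
    (continuous_mulVecLp n n).comp (continuous_subtype_val.prodMk continuous_const)
  have hm : MeasurableSet {Q : orthoGroup n | mulVecLp (Q : Matrix (Fin n) (Fin n) ℝ) y ∈ B} :=
    hc.measurable hB
  conv_rhs => rw [← map_mul_right_orthoHaar R]
  rw [Measure.map_apply (continuous_mul_const R).measurable hm]
  congr 1
  ext Q
  simp only [Set.mem_ofPred_eq, Set.mem_preimage, Submonoid.coe_mul, mulVecLp_mul, hR]

theorem map_mulVecLp_stdGaussian {n : ℕ} (Q : orthoGroup n) :
    (stdGaussian (EuclideanSpace ℝ (Fin n))).map (mulVecLp (Q : Matrix (Fin n) (Fin n) ℝ))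
      = stdGaussian (EuclideanSpace ℝ (Fin n)) := by
  let f : EuclideanSpace ℝ (Fin n) →ₗᵢ[ℝ] EuclideanSpace ℝ (Fin n) :=
    { toFun := mulVecLp (Q : Matrix (Fin n) (Fin n) ℝ)
      map_add' := fun x y => by simp [mulVecLp, Matrix.mulVec_add]
      map_smul' := fun c x => by simp [mulVecLp, Matrix.mulVec_smul]
      norm_map' := norm_mulVecLp (orthoGroup_transpose_mul Q) }
  exact stdGaussian_map (f.toLinearIsometryEquiv rfl)

theorem stdGaussian_singleton_zero {n : ℕ} (hn : 1 ≤ n) :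
    stdGaussian (EuclideanSpace ℝ (Fin n)) {0} = 0 := by
  have : NullSingletonClass (gaussianReal 0 1) := nullSingletonClass_gaussianReal one_ne_zero
  have : Nonempty (Fin n) := ⟨⟨0, hn⟩⟩
  rw [← map_pi_eq_stdGaussian, Measure.map_apply (by fun_prop) (measurableSet_singleton _)]
  refine measure_mono_null (t := {0}) ?_ (measure_singleton _)
  intro x hx
  simpa using hx

/-- Compute the probability of `Q ((‖v‖ / ‖g‖) g) ∈ B` for independent `Q` and `g` in two ways. For
fixed `Q`, rotation invariance of the Gaussian removes `Q`; for fixed `g ≠ 0`, the answer depends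
only on the norm `‖v‖` of the vector being rotated. -/
theorem stiefelHaar_mulVecLp {n k : ℕ} (h : k ≤ n) (hn : 1 ≤ n) (v : EuclideanSpace ℝ (Fin k))
    {B : Set (EuclideanSpace ℝ (Fin n))} (hB : MeasurableSet B) :
    stiefelHaar h {A | mulVecLp (A : Matrix (Fin n) (Fin k) ℝ) v ∈ B}
      = stdGaussian (EuclideanSpace ℝ (Fin n)) {g | (‖v‖ / ‖g‖) • g ∈ B} := by
  -- A Haar frame is `Q E`, which turns `A v` into `Q (E v)` with `‖E v‖ = ‖v‖`.
  set E : Matrix (Fin n) (Fin k) ℝ := (1 : Matrix (Fin n) (Fin n) ℝ).submatrix id (Fin.castLE h)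
    with hE
  set γ := stdGaussian (EuclideanSpace ℝ (Fin n)) with hγ
  have hcol : ∀ Q : orthoGroup n, (firstColumns h Q : Matrix (Fin n) (Fin k) ℝ)
      = (Q : Matrix (Fin n) (Fin n) ℝ) * E := fun Q => by
    ext i j
    simp [firstColumns, hE, Matrix.mul_apply, Matrix.one_apply]
  have hEE : Eᵀ * E = 1 := by
    have := (firstColumns h 1).2
    rwa [mem_stiefel, hcol, OneMemClass.coe_one, Matrix.one_mul] at this
  have hw : ‖mulVecLp E v‖ = ‖v‖ := norm_mulVecLp hEE v
  have hcA : Continuous fun A : stiefel n k => mulVecLp (A : Matrix (Fin n) (Fin k) ℝ) v :=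
    (continuous_mulVecLp n k).comp (continuous_subtype_val.prodMk continuous_const)
  have hmA : MeasurableSet {A : stiefel n k | mulVecLp (A : Matrix (Fin n) (Fin k) ℝ) v ∈ B} :=
    hcA.measurable hB
  rw [stiefelHaar, Measure.map_apply (continuous_firstColumns h).measurable hmA]
  have hset : (firstColumns h) ⁻¹' {A | mulVecLp (A : Matrix (Fin n) (Fin k) ℝ) v ∈ B}
      = {Q : orthoGroup n | mulVecLp (Q : Matrix (Fin n) (Fin n) ℝ) (mulVecLp E v) ∈ B} := by
    ext Q
    simp only [Set.mem_preimage, Set.mem_ofPred_eq, hcol, mulVecLp_mul]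
  rw [hset]
  have : SecondCountableTopology (Matrix (Fin n) (Fin n) ℝ) :=
    inferInstanceAs (SecondCountableTopology (Fin n → Fin n → ℝ))
  have hnorm : Measurable fun g : EuclideanSpace ℝ (Fin n) => (‖v‖ / ‖g‖) • g :=
    (measurable_const.div measurable_norm).smul measurable_id
  have hS : MeasurableSet {p : orthoGroup n × EuclideanSpace ℝ (Fin n) |
      mulVecLp (p.1 : Matrix (Fin n) (Fin n) ℝ) ((‖v‖ / ‖p.2‖) • p.2) ∈ B} := by
    have hm : Measurable fun p : orthoGroup n × EuclideanSpace ℝ (Fin n) =>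
        mulVecLp (p.1 : Matrix (Fin n) (Fin n) ℝ) p.2 :=
      ((continuous_mulVecLp n n).comp
        ((continuous_subtype_val.comp continuous_fst).prodMk continuous_snd)).measurable
    exact (hm.comp (measurable_fst.prodMk (hnorm.comp measurable_snd))) hB
  have h1 := Measure.prod_apply (μ := orthoHaar n) (ν := γ) hS
  have h2 := Measure.prod_apply_symm (μ := orthoHaar n) (ν := γ) hS
  have e1 : ∀ Q : orthoGroup n, γ (Prod.mk Q ⁻¹' {p : orthoGroup n × EuclideanSpace ℝ (Fin n) |
      mulVecLp (p.1 : Matrix (Fin n) (Fin n) ℝ) ((‖v‖ / ‖p.2‖) • p.2) ∈ B})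
      = γ {g | (‖v‖ / ‖g‖) • g ∈ B} := fun Q => by
    have hcQ : Continuous (mulVecLp (Q : Matrix (Fin n) (Fin n) ℝ)) :=
      (continuous_mulVecLp n n).comp (continuous_const.prodMk continuous_id)
    conv_rhs => rw [hγ, ← map_mulVecLp_stdGaussian Q]
    have hmB : MeasurableSet {g : EuclideanSpace ℝ (Fin n) | (‖v‖ / ‖g‖) • g ∈ B} := hnorm hB
    rw [Measure.map_apply hcQ.measurable hmB]
    congr 1
    ext g
    simp only [Set.mem_preimage, Set.mem_ofPred_eq, norm_mulVecLp (orthoGroup_transpose_mul Q)]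
    simp [mulVecLp, Matrix.mulVec_smul]
  have e2 : ∀ᵐ g ∂γ, orthoHaar n ((fun Q => (Q, g)) ⁻¹'
      {p : orthoGroup n × EuclideanSpace ℝ (Fin n) |
        mulVecLp (p.1 : Matrix (Fin n) (Fin n) ℝ) ((‖v‖ / ‖p.2‖) • p.2) ∈ B})
      = orthoHaar n {Q : orthoGroup n |
          mulVecLp (Q : Matrix (Fin n) (Fin n) ℝ) (mulVecLp E v) ∈ B} := by
    have h0 : ∀ᵐ g ∂γ, g ≠ 0 := by
      rw [ae_iff]
      simpa using stdGaussian_singleton_zero hn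
    filter_upwards [h0] with g hg
    have hgn : ‖(‖v‖ / ‖g‖) • g‖ = ‖mulVecLp E v‖ := by
      rw [norm_smul, hw, norm_div, norm_norm, norm_norm,
        div_mul_cancel₀ _ (norm_ne_zero_iff.2 hg)]
    exact orthoHaar_orbit_eq hgn hB
  rw [lintegral_congr e1, lintegral_const, measure_univ, mul_one] at h1
  rw [lintegral_congr_ae e2, lintegral_const, measure_univ, mul_one] at h2
  rw [← h2, h1]

/-! ### Exponential concentration of averages of independent variables -/

/-- The cumulant generating function vanishes at `0` with slope the mean, so just to the right of
`0` it lies below any line through the origin of larger slope. -/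
theorem exists_pos_cgf_lt {Ω : Type*} [MeasurableSpace Ω] {γ : Measure Ω} [IsProbabilityMeasure γ]
    {Y : Ω → ℝ} (h0 : 0 ∈ interior (integrableExpSet Y γ)) {ε : ℝ} (hε : 0 < ε) :
    ∃ t : ℝ, 0 < t ∧ t ∈ integrableExpSet Y γ ∧ cgf Y γ t < t * (γ[Y] + ε) := by
  have hd : HasDerivAt (cgf Y γ) γ[Y] 0 := by
    have h1 := (analyticAt_cgf h0).differentiableAt.hasDerivAt
    rwa [deriv_cgf_zero h0, probReal_univ, div_one] at h1
  have hs : Tendsto (slope (cgf Y γ) 0) (𝓝[>] 0) (𝓝 γ[Y]) :=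
    (hasDerivAt_iff_tendsto_slope.1 hd).mono_left
      (nhdsWithin_mono _ fun _ hx => ne_of_gt (Set.mem_Ioi.1 hx))
  have h2 : ∀ᶠ t in 𝓝[>] (0 : ℝ), slope (cgf Y γ) 0 t < γ[Y] + ε :=
    hs.eventually_lt_const (by linarith)
  have h3 : ∀ᶠ t in 𝓝[>] (0 : ℝ), t ∈ integrableExpSet Y γ :=
    mem_nhdsWithin_of_mem_nhds (mem_interior_iff_mem_nhds.1 h0)
  obtain ⟨t, h4, h5, h6⟩ := (h2.and (h3.and self_mem_nhdsWithin)).exists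
  refine ⟨t, h6, h5, ?_⟩
  rw [slope_def_field, cgf_zero, sub_zero, sub_zero, div_lt_iff₀ h6] at h4
  linarith

/-- Chernoff's bound at the `t` of `exists_pos_cgf_lt`; the rate `t (mean + ε) - cgf t` does not
depend on `n`. -/
theorem exists_pi_sum_ge_le_exp {Ω : Type*} [MeasurableSpace Ω] {γ : Measure Ω}
    [IsProbabilityMeasure γ] {Y : Ω → ℝ} (hY : Measurable Y)
    (h0 : 0 ∈ interior (integrableExpSet Y γ)) {ε : ℝ} (hε : 0 < ε) :
    ∃ c : ℝ, 0 < c ∧ ∀ n : ℕ, (Measure.pi fun _ : Fin n => γ).real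
      {x | n * (γ[Y] + ε) ≤ ∑ i, Y (x i)} ≤ Real.exp (-c * n) := by
  obtain ⟨t, ht, hti, hlt⟩ := exists_pos_cgf_lt h0 hε
  refine ⟨t * (γ[Y] + ε) - cgf Y γ t, by linarith, fun n => ?_⟩
  have hind : iIndepFun (fun (i : Fin n) (x : Fin n → Ω) => Y (x i)) (Measure.pi fun _ => γ) :=
    iIndepFun_pi fun _ => hY.aemeasurable
  have hm : ∀ i : Fin n, Measurable fun x : Fin n → Ω => Y (x i) := fun i =>
    hY.comp (measurable_pi_apply i)
  have hmap : ∀ i : Fin n, (Measure.pi fun _ : Fin n => γ).map (fun x => x i) = γ := fun i =>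
    (measurePreserving_eval (fun _ : Fin n => γ) i).map_eq
  have hint : ∀ i : Fin n, Integrable (fun x : Fin n → Ω => Real.exp (t * Y (x i)))
      (Measure.pi fun _ => γ) := fun i =>
    (measurePreserving_eval (fun _ : Fin n => γ) i).integrable_comp_of_integrable
      (g := fun y => Real.exp (t * Y y)) hti
  have hcgf : ∀ i : Fin n, cgf (fun x : Fin n → Ω => Y (x i)) (Measure.pi fun _ => γ) t
      = cgf Y γ t := fun i => by
    have h := mgf_map (measurable_pi_apply i).aemeasurable (X := Y) (t := t)
      (μ := Measure.pi fun _ : Fin n => γ) (by rw [hmap i]; exact hti.aestronglyMeasurable)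
    rw [hmap i] at h
    rw [cgf, cgf, h]
    rfl
  have hsum := hind.cgf_sum hm (s := Finset.univ) (t := t) fun i _ => hint i
  have hI := hind.integrable_exp_mul_sum hm (s := Finset.univ) (t := t) fun i _ => hint i
  have := measure_ge_le_exp_cgf (n * (γ[Y] + ε)) ht.le hI
  rw [hsum] at this
  simp only [hcgf, Finset.sum_const, Finset.card_univ, Fintype.card_fin, nsmul_eq_mul,
    Finset.sum_apply] at this
  refine this.trans (Real.exp_le_exp.2 (le_of_eq ?_))
  ring

theorem exists_pi_abs_sum_sub_ge_le_exp {Ω : Type*} [MeasurableSpace Ω] {γ : Measure Ω}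
    [IsProbabilityMeasure γ] {Y : Ω → ℝ} (hY : Measurable Y)
    (h0 : 0 ∈ interior (integrableExpSet Y γ)) {ε : ℝ} (hε : 0 < ε) :
    ∃ c : ℝ, 0 < c ∧ ∀ n : ℕ, (Measure.pi fun _ : Fin n => γ).real
      {x | n * ε ≤ |∑ i, Y (x i) - n * γ[Y]|} ≤ 2 * Real.exp (-c * n) := by
  have h0' : 0 ∈ interior (integrableExpSet (fun x => -Y x) γ) := by
    have : integrableExpSet (fun x => -Y x) γ = Neg.neg ⁻¹' integrableExpSet Y γ := by
      ext t
      simp [integrableExpSet]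
    rw [this]
    exact preimage_interior_subset_interior_preimage continuous_neg (by simpa using h0)
  obtain ⟨c₁, hc₁, h₁⟩ := exists_pi_sum_ge_le_exp hY h0 hε
  obtain ⟨c₂, hc₂, h₂⟩ := exists_pi_sum_ge_le_exp hY.neg h0' hε
  refine ⟨min c₁ c₂, lt_min hc₁ hc₂, fun n => ?_⟩
  have hsub : {x : Fin n → Ω | n * ε ≤ |∑ i, Y (x i) - n * γ[Y]|} ⊆
      {x | n * (γ[Y] + ε) ≤ ∑ i, Y (x i)} ∪
        {x | n * (γ[fun x => -Y x] + ε) ≤ ∑ i, -Y (x i)} := by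
    intro x hx
    simp only [Set.mem_union, Set.mem_ofPred_eq, integral_neg, Finset.sum_neg_distrib] at hx ⊢
    rcases le_abs.1 hx with h | h
    · left; linarith
    · right; linarith
  refine (measureReal_mono hsub).trans ((measureReal_union_le _ _).trans ?_)
  have hn : (0 : ℝ) ≤ n := n.cast_nonneg
  have e₁ : Real.exp (-c₁ * n) ≤ Real.exp (-min c₁ c₂ * n) :=
    Real.exp_le_exp.2 (mul_le_mul_of_nonneg_right (neg_le_neg (min_le_left _ _)) hn)
  have e₂ : Real.exp (-c₂ * n) ≤ Real.exp (-min c₁ c₂ * n) :=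
    Real.exp_le_exp.2 (mul_le_mul_of_nonneg_right (neg_le_neg (min_le_right _ _)) hn)
  have hb₁ := h₁ n
  have hb₂ := h₂ n
  simp only [Pi.neg_apply] at hb₂
  linarith

/-! ### Gaussian exponential moments of functions of quadratic growth -/

theorem integrable_exp_sq_div_four_gaussianReal :
    Integrable (fun x : ℝ => Real.exp (x ^ 2 / 4)) (gaussianReal 0 1) := by
  rw [gaussianReal_of_var_ne_zero _ one_ne_zero,
    integrable_withDensity_iff_integrable_smul' (measurable_gaussianPDF _ _)
      (ae_of_all _ fun _ => gaussianPDF_lt_top)]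
  have h := (integrable_exp_neg_mul_sq (b := 1 / 4) (by norm_num)).const_mul
    (√(2 * Real.pi * (1 : NNReal)))⁻¹
  refine h.congr (ae_of_all _ fun x => ?_)
  simp only [toReal_gaussianPDF, gaussianPDFReal, smul_eq_mul, sub_zero]
  have hexp : Real.exp (-(1 / 4) * x ^ 2)
      = Real.exp (-x ^ 2 / (2 * (1 : NNReal))) * Real.exp (x ^ 2 / 4) := by
    rw [← Real.exp_add]
    congr 1
    push_cast
    ring
  rw [hexp, ← mul_assoc]

theorem zero_mem_interior_integrableExpSet_gaussianReal {Y : ℝ → ℝ} (hY : Measurable Y) {A B : ℝ}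
    (h : ∀ x, |Y x| ≤ A + B * x ^ 2) :
    0 ∈ interior (integrableExpSet Y (gaussianReal 0 1)) := by
  have hA : 0 ≤ A := by simpa using (abs_nonneg _).trans (h 0)
  -- This radius gives `|t| |B| ≤ 1/4`, within reach of the integrability of `exp (x² / 4)`; adding
  -- `1` avoids dividing by zero.
  have hδ : 0 < 1 / (4 * (|B| + 1)) := by positivity
  refine mem_interior_iff_mem_nhds.2 (mem_of_superset (Metric.ball_mem_nhds 0 hδ) fun t ht => ?_)
  have ht' : |t| * (|B| + 1) ≤ 1 / 4 := by
    rw [mem_ball_zero_iff, Real.norm_eq_abs, lt_div_iff₀ (by positivity)] at ht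
    linarith
  refine (integrable_exp_sq_div_four_gaussianReal.const_mul (Real.exp (|t| * A))).mono'
    (by fun_prop) (ae_of_all _ fun x => ?_)
  rw [Real.norm_eq_abs, abs_of_pos (Real.exp_pos _), ← Real.exp_add, Real.exp_le_exp]
  calc t * Y x ≤ |t| * |Y x| := by rw [← abs_mul]; exact le_abs_self _
    _ ≤ |t| * (A + (|B| + 1) * x ^ 2) := by
      gcongr
      refine (h x).trans ?_
      gcongr
      linarith [le_abs_self B]
    _ = |t| * A + |t| * (|B| + 1) * x ^ 2 := by ring
    _ ≤ |t| * A + 1 / 4 * x ^ 2 := by gcongr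
    _ = |t| * A + x ^ 2 / 4 := by ring

theorem integral_sq_gaussianReal : ∫ x, x ^ 2 ∂gaussianReal 0 1 = 1 := by
  have h := variance_fun_id_gaussianReal (μ := 0) (v := 1)
  rw [variance_eq_integral (by fun_prop)] at h
  simpa [integral_id_gaussianReal] using h

/-! ### Functions with linearly growing Lipschitz constant -/

/-- `G` is locally Lipschitz, with a constant that grows at most linearly. -/
def LinearlyLipschitz (K : ℝ) (G : ℝ → ℝ) : Prop :=
  ∀ s t, |G s - G t| ≤ K * (1 + |s| + |t|) * |s - t|

theorem linearlyLipschitz_of_abs_deriv_le {G : ℝ → ℝ} {K : ℝ} (hG : Differentiable ℝ G)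
    (h : ∀ t, |deriv G t| ≤ K * (1 + |t|)) : LinearlyLipschitz K G := by
  intro s t
  have hK : 0 ≤ K := by simpa using (abs_nonneg _).trans (h 0)
  refine Convex.norm_image_sub_le_of_norm_deriv_le (s := Set.uIcc t s) (f := G)
    (fun x _ => hG x) (fun x hx => ?_) (convex_uIcc _ _) Set.left_mem_uIcc Set.right_mem_uIcc
  refine (h x).trans (mul_le_mul_of_nonneg_left ?_ hK)
  have hx' : |x| ≤ |s| + |t| := by
    rcases Set.mem_uIcc.1 hx with hx | hx
    · refine (abs_le_max_abs_abs hx.1 hx.2).trans (max_le ?_ ?_) <;>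
        linarith [abs_nonneg s, abs_nonneg t]
    · refine (abs_le_max_abs_abs hx.1 hx.2).trans (max_le ?_ ?_) <;>
        linarith [abs_nonneg s, abs_nonneg t]
  linarith

theorem abs_le_one_add_sq (y : ℝ) : |y| ≤ 1 + y ^ 2 := by
  rw [← sq_abs]
  nlinarith [sq_nonneg (|y| - 1), abs_nonneg y]

namespace LinearlyLipschitz

variable {K : ℝ} {G : ℝ → ℝ}

theorem nonneg (hG : LinearlyLipschitz K G) : 0 ≤ K := by
  have h := (abs_nonneg _).trans (hG 1 0)
  norm_num at h
  linarith

theorem continuous (hG : LinearlyLipschitz K G) : Continuous G := by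
  refine continuous_iff_continuousAt.2 fun t => ?_
  rw [ContinuousAt, tendsto_iff_norm_sub_tendsto_zero]
  have h : Tendsto (fun s => K * (1 + |s| + |t|) * |s - t|) (𝓝 t) (𝓝 0) := by
    have hc : Continuous fun s => K * (1 + |s| + |t|) * |s - t| := by fun_prop
    simpa using hc.tendsto t
  exact squeeze_zero (fun _ => norm_nonneg _) (fun s => hG s t) h

theorem abs_comp_mul_le (hG : LinearlyLipschitz K G) (D x : ℝ) :
    |G (D * x)| ≤ |G 0| + K + 2 * K * D ^ 2 * x ^ 2 := by
  have h1 := hG (D * x) 0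
  have h2 : |G (D * x)| ≤ |G 0| + |G (D * x) - G 0| := by
    have := abs_add_le (G 0) (G (D * x) - G 0)
    rwa [add_sub_cancel] at this
  rw [abs_zero, add_zero, sub_zero] at h1
  have h3 : K * (1 + |D * x|) * |D * x| ≤ K * (1 + 2 * (D * x) ^ 2) := by
    rw [mul_assoc]
    refine mul_le_mul_of_nonneg_left ?_ hG.nonneg
    have := abs_le_one_add_sq (D * x)
    have e := sq_abs (D * x)
    nlinarith
  nlinarith

theorem zero_mem_interior_integrableExpSet (hG : LinearlyLipschitz K G) (D : ℝ) :
    0 ∈ interior (integrableExpSet (fun x => G (D * x)) (gaussianReal 0 1)) :=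
  zero_mem_interior_integrableExpSet_gaussianReal
    (hG.continuous.comp (continuous_const_mul D)).measurable (hG.abs_comp_mul_le D)

theorem integrable_comp_mul (hG : LinearlyLipschitz K G) (D : ℝ) :
    Integrable (fun x => G (D * x)) (gaussianReal 0 1) :=
  integrable_of_mem_interior_integrableExpSet (hG.zero_mem_interior_integrableExpSet D)

/-- The cost of removing a common scale factor: each increment is `(r - 1) yᵢ`, and the linear
Lipschitz constant times `|yᵢ|` is of order `1 + yᵢ²`. -/
theorem abs_sum_comp_mul_sub_sum_le {n : ℕ} (hG : LinearlyLipschitz K G) (r : ℝ)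
    (y : Fin n → ℝ) :
    |∑ i, G (r * y i) - ∑ i, G (y i)| ≤ K * |r - 1| * (n + (2 + |r|) * ∑ i, y i ^ 2) := by
  rw [← Finset.sum_sub_distrib]
  refine (Finset.abs_sum_le_sum_abs _ _).trans ?_
  have hterm : ∀ i, |G (r * y i) - G (y i)| ≤ K * |r - 1| * (1 + (2 + |r|) * y i ^ 2) := by
    intro i
    refine (hG _ _).trans ?_
    have e : r * y i - y i = (r - 1) * y i := by ring
    rw [e, abs_mul, abs_mul]
    have h1 := abs_le_one_add_sq (y i)
    have h2 : |y i| * |y i| = y i ^ 2 := by rw [← sq, sq_abs]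
    have h3 : (1 + |r| * |y i| + |y i|) * |y i| ≤ 1 + (2 + |r|) * y i ^ 2 := by
      calc (1 + |r| * |y i| + |y i|) * |y i| = |y i| + (|r| + 1) * (|y i| * |y i|) := by ring
        _ ≤ 1 + (2 + |r|) * y i ^ 2 := by rw [h2]; linarith
    calc K * (1 + |r| * |y i| + |y i|) * (|r - 1| * |y i|)
        = K * |r - 1| * ((1 + |r| * |y i| + |y i|) * |y i|) := by ring
      _ ≤ _ := mul_le_mul_of_nonneg_left h3 (mul_nonneg hG.nonneg (abs_nonneg _))
  refine (Finset.sum_le_sum fun i _ => hterm i).trans (le_of_eq ?_)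
  rw [← Finset.mul_sum, Finset.sum_add_distrib, ← Finset.mul_sum]
  simp

end LinearlyLipschitz

/-! ### Concentration on the Stiefel manifold -/

/-- With `s = √n / √q ≥ 0`, `|s - 1| ≤ |s² - 1| = |q - n| / q`, and `q ≥ n / 2`. -/
theorem abs_sqrt_div_sqrt_sub_one_le {n q δ : ℝ} (hn : 0 < n) (hδ : δ ≤ 1 / 2)
    (h : |q - n| ≤ n * δ) : |√n / √q - 1| ≤ 2 * δ := by
  have hq : n / 2 ≤ q := by
    have := (abs_le.1 h).1
    nlinarith
  have hq0 : 0 < q := by linarith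
  have hr : 0 ≤ √n / √q := by positivity
  have hr2 : (√n / √q) ^ 2 = n / q := by rw [div_pow, Real.sq_sqrt hn.le, Real.sq_sqrt hq0.le]
  calc |√n / √q - 1| ≤ |√n / √q - 1| * |√n / √q + 1| := by
        refine le_mul_of_one_le_right (abs_nonneg _) ?_
        rw [abs_of_nonneg (by linarith)]
        linarith
    _ = |q - n| / q := by
        rw [abs_sub_comm q n, ← abs_mul, ← abs_of_pos hq0, ← abs_div, abs_of_pos hq0]
        congr 1
        rw [sub_div, div_self hq0.ne', ← hr2]
        ring
    _ ≤ 2 * δ := by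
        rw [div_le_iff₀ hq0]
        have : 0 ≤ δ := by
          have := (abs_nonneg _).trans h
          exact nonneg_of_mul_nonneg_right this hn
        nlinarith

theorem rowProj_eq_sqrt_mul {n k : ℕ} (v : EuclideanSpace ℝ (Fin k)) (a : stiefel n k)
    (i : Fin n) :
    rowProj v a i = √(n : ℝ) * mulVecLp (a : Matrix (Fin n) (Fin k) ℝ) v i := by
  simp [rowProj, mulVecLp, inner_smul_right, EuclideanSpace.inner_eq_star_dotProduct,
    Matrix.mulVec]

theorem measurableSet_deviation {G : ℝ → ℝ} (hG : Continuous G) (n : ℕ) (m ε : ℝ) :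
    MeasurableSet {u : EuclideanSpace ℝ (Fin n) |
      ε ≤ |(1 / (n : ℝ)) * ∑ i, G (√(n : ℝ) * u i) - m|} := by
  refine (isClosed_le continuous_const ?_).measurableSet
  fun_prop

theorem exists_stiefelHaar_deviation_le {K : ℝ} {G : ℝ → ℝ} (hG : LinearlyLipschitz K G) (D : ℝ)
    {ε : ℝ} (hε : 0 < ε) :
    ∃ c : ℝ, 0 < c ∧ ∀ (n k : ℕ) (h : k ≤ n), 1 ≤ n → ∀ v : EuclideanSpace ℝ (Fin k), ‖v‖ = D →
      (stiefelHaar h).real {a | ε ≤ |(1 / (n : ℝ)) * ∑ i, G (rowProj v a i)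
        - ∫ x, G (D * x) ∂gaussianReal 0 1|} ≤ 4 * Real.exp (-c * n) := by
  have hK := hG.nonneg
  set m := ∫ x, G (D * x) ∂gaussianReal 0 1 with hm
  -- Chosen so that `|r - 1| ≤ 2 δ`, `|r| ≤ 2` and `q ≤ 2 n` bound the rescaling error by `n δ M / 4
  -- ≤ n ε / 4`; `K + 1` keeps `M` positive.
  set M := 8 * (K + 1) * (1 + 8 * D ^ 2) with hM
  have hM0 : 0 < M := by positivity
  set δ := min (1 / 2) (ε / M) with hδ
  have hδ0 : 0 < δ := lt_min (by norm_num) (by positivity)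
  have hδh : δ ≤ 1 / 2 := min_le_left _ _
  have hδM : δ * M ≤ ε := by
    rw [← le_div_iff₀ hM0]
    exact min_le_right _ _
  obtain ⟨c₁, hc₁, h₁⟩ := exists_pi_abs_sum_sub_ge_le_exp
    (hG.continuous.comp (continuous_const_mul D)).measurable
    (hG.zero_mem_interior_integrableExpSet D) (half_pos hε)
  obtain ⟨c₂, hc₂, h₂⟩ := exists_pi_abs_sum_sub_ge_le_exp (Y := fun x : ℝ => x ^ 2)
    (γ := gaussianReal 0 1) (by fun_prop)
    (zero_mem_interior_integrableExpSet_gaussianReal (A := 0) (B := 1) (by fun_prop)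
      (by simp)) hδ0
  refine ⟨min c₁ c₂, lt_min hc₁ hc₂, fun n k h hn v hv => ?_⟩
  have hn0 : (0 : ℝ) < n := by exact_mod_cast hn
  have hB := measurableSet_deviation hG.continuous n m ε
  set B := {u : EuclideanSpace ℝ (Fin n) | ε ≤ |(1 / (n : ℝ)) * ∑ i, G (√(n : ℝ) * u i) - m|}
    with hBdef
  have hset : {a : stiefel n k | ε ≤ |(1 / (n : ℝ)) * ∑ i, G (rowProj v a i) - m|}
      = {a : stiefel n k | mulVecLp (a : Matrix (Fin n) (Fin k) ℝ) v ∈ B} := by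
    ext a
    simp only [hBdef, Set.mem_ofPred_eq, rowProj_eq_sqrt_mul]
  have hnorm : Measurable fun g : EuclideanSpace ℝ (Fin n) => (‖v‖ / ‖g‖) • g :=
    (measurable_const.div measurable_norm).smul measurable_id
  have hmB : MeasurableSet {g : EuclideanSpace ℝ (Fin n) | (‖v‖ / ‖g‖) • g ∈ B} := hnorm hB
  rw [hset, measureReal_def, stiefelHaar_mulVecLp h hn v hB, ← map_pi_eq_stdGaussian,
    Measure.map_apply (by fun_prop) hmB, ← measureReal_def]
  -- Off both exceptional events the total error is below `ε / 2 + ε / 4 < ε`.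
  have hsub : (WithLp.toLp 2 : (Fin n → ℝ) → EuclideanSpace ℝ (Fin n)) ⁻¹'
        {g | (‖v‖ / ‖g‖) • g ∈ B} ⊆
      {x | n * (ε / 2) ≤ |∑ i, (G ∘ fun y => D * y) (x i) - n * m|} ∪
        {x | n * δ ≤ |∑ i, x i ^ 2 - n * ∫ y, y ^ 2 ∂gaussianReal 0 1|} := by
    intro x hx
    by_contra hcon
    simp only [Set.mem_union, Set.mem_ofPred_eq, not_or, not_le, integral_sq_gaussianReal,
      mul_one, Function.comp_apply] at hcon
    obtain ⟨hx₁, hx₂⟩ := hcon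
    set q := ∑ i, x i ^ 2 with hq
    have hr := abs_sqrt_div_sqrt_sub_one_le hn0 hδh hx₂.le
    set r := √(n : ℝ) / √q with hrdef
    have hxB : ε ≤ |(1 / (n : ℝ)) * ∑ i, G (r * (D * x i)) - m| := by
      have hx' : WithLp.toLp 2 x ∈ {g : EuclideanSpace ℝ (Fin n) | (‖v‖ / ‖g‖) • g ∈ B} := hx
      have hnx : ‖(WithLp.toLp 2 x : EuclideanSpace ℝ (Fin n))‖ = √q := by
        simp [EuclideanSpace.norm_eq, hq]
      simp only [hBdef, Set.mem_ofPred_eq, hv, hnx, PiLp.smul_apply, smul_eq_mul] at hx'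
      refine hx'.trans (le_of_eq ?_)
      congr 3
      refine Finset.sum_congr rfl fun i _ => ?_
      congr 1
      rw [hrdef]
      ring
    have hcomp := hG.abs_sum_comp_mul_sub_sum_le r fun i => D * x i
    simp only [mul_pow, ← Finset.mul_sum] at hcomp
    have hrabs : |r| ≤ 2 := by
      have := abs_add_le (r - 1) 1
      rw [sub_add_cancel, abs_one] at this
      linarith
    have hq2 : q ≤ 2 * n := by
      have := (abs_le.1 hx₂.le).2
      nlinarith
    have hq0 : 0 ≤ q := Finset.sum_nonneg fun i _ => sq_nonneg _
    have hcomp' : |∑ i, G (r * (D * x i)) - ∑ i, G (D * x i)| ≤ n * (ε / 4) := by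
      calc _ ≤ K * |r - 1| * (n + (2 + |r|) * (D ^ 2 * q)) := hcomp
        _ ≤ (K + 1) * (2 * δ) * (n + (2 + 2) * (D ^ 2 * (2 * n))) := by gcongr; linarith
        _ = n * (δ * M / 4) := by rw [hM]; ring
        _ ≤ n * (ε / 4) := by gcongr
    have htot : |∑ i, G (r * (D * x i)) - n * m| < n * ε := by
      have := abs_sub_le (∑ i, G (r * (D * x i))) (∑ i, G (D * x i)) (n * m)
      nlinarith
    have heq : (1 / (n : ℝ)) * ∑ i, G (r * (D * x i)) - m
        = (1 / n) * (∑ i, G (r * (D * x i)) - n * m) := by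
      field_simp
    rw [heq, abs_mul, abs_of_pos (by positivity), one_div, ← div_eq_inv_mul, le_div_iff₀ hn0] at hxB
    linarith
  refine (measureReal_mono hsub).trans ((measureReal_union_le _ _).trans ?_)
  have e₁ : Real.exp (-c₁ * n) ≤ Real.exp (-min c₁ c₂ * n) :=
    Real.exp_le_exp.2 (mul_le_mul_of_nonneg_right (neg_le_neg (min_le_left _ _)) hn0.le)
  have e₂ : Real.exp (-c₂ * n) ≤ Real.exp (-min c₁ c₂ * n) :=
    Real.exp_le_exp.2 (mul_le_mul_of_nonneg_right (neg_le_neg (min_le_right _ _)) hn0.le)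
  have hb₁ := h₁ n
  have hb₂ := h₂ n
  simp only [Function.comp_apply, ← hm] at hb₁ ⊢
  linarith

/-! ### Almost sure uniform convergence -/

theorem ae_eventually_pnat_of_measure_le {α : Type*} [MeasurableSpace α] {μ : Measure α}
    {S : ℕ+ → Set α} {A c : ℝ} (hc : 0 < c)
    (h : ∀ᶠ n : ℕ+ in atTop, μ (S n) ≤ ENNReal.ofReal (A * Real.exp (-c * (n : ℕ)))) :
    ∀ᵐ a ∂μ, ∀ᶠ n in atTop, a ∉ S n := by
  obtain ⟨N, hN⟩ := eventually_atTop.1 h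
  have hsum : ∑' m : ℕ, μ (S (Nat.succPNat (m + N))) ≠ ∞ := by
    have hs : Summable fun m : ℕ => A * Real.exp (-c * ((m + N + 1 : ℕ) : ℝ)) := by
      refine Summable.mul_left A ?_
      have h1 : Summable fun m : ℕ => Real.exp ((m : ℝ) * -c) :=
        Real.summable_exp_nat_mul_iff.2 (neg_lt_zero.2 hc)
      refine ((summable_nat_add_iff (N + 1)).2 h1).congr fun m => ?_
      rw [mul_comm, add_assoc]
    refine ne_top_of_le_ne_top hs.tsum_ofReal_ne_top (ENNReal.tsum_le_tsum fun m => ?_)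
    refine hN _ ?_
    rw [← PNat.coe_le_coe, Nat.succPNat_coe]
    omega
  filter_upwards [ae_eventually_notMem hsum] with a ha
  obtain ⟨M, hM⟩ := eventually_atTop.1 ha
  refine eventually_atTop.2 ⟨Nat.succPNat (M + N), fun n hn => ?_⟩
  rw [← PNat.coe_le_coe, Nat.succPNat_coe] at hn
  -- `succPNat` adds one, so index `m` of the shifted series is the positive integer `m + N + 1`.
  have hn' : n = Nat.succPNat ((n : ℕ) - 1 - N + N) := by
    apply PNat.eq
    rw [Nat.succPNat_coe]
    omega
  rw [hn']
  exact hM _ (by omega)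

theorem eventually_natCast_le_exp_of_limsup_log_eq_zero {d : ℕ+ → ℕ} (hd_pos : ∀ n, 1 ≤ d n)
    (hd : limsup (fun n : ℕ+ => ((Real.log (d n) / (n : ℕ) : ℝ) : EReal)) atTop = 0)
    {c : ℝ} (hc : 0 < c) : ∀ᶠ n : ℕ+ in atTop, (d n : ℝ) ≤ Real.exp (c * (n : ℕ)) := by
  have hlt : limsup (fun n : ℕ+ => ((Real.log (d n) / (n : ℕ) : ℝ) : EReal)) atTop < (c : EReal) := by
    rw [hd]
    exact_mod_cast hc
  filter_upwards [eventually_lt_of_limsup_lt hlt] with n hn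
  have hn0 : (0 : ℝ) < (n : ℕ) := by exact_mod_cast n.pos
  have hdn : (0 : ℝ) < d n := by exact_mod_cast hd_pos n
  rw [EReal.coe_lt_coe_iff, div_lt_iff₀ hn0] at hn
  rw [← Real.log_le_iff_le_exp hdn]
  exact hn.le

/-- The union bound costs a factor `d n ≤ exp (c n / 2)` against `exp (-c n)`, which leaves a
summable tail. Running over the thresholds `1 / (p + 1)` keeps the exceptional sets countable in
number. -/
theorem ae_tendsto_iSup_deviation {k : ℕ+ → ℕ} (hk : ∀ n : ℕ+, k n ≤ (n : ℕ))
    {σ : Measure (∀ n : ℕ+, stiefel n (k n))}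
    (hσ : ∀ n : ℕ+, σ.map (fun a => a n) = stiefelHaar (hk n))
    {D : ℝ} {d : ℕ+ → ℕ} (hd_pos : ∀ n, 1 ≤ d n)
    (hd : limsup (fun n : ℕ+ => ((Real.log (d n) / (n : ℕ) : ℝ) : EReal)) atTop = 0)
    {v : ∀ n : ℕ+, Fin (d n) → EuclideanSpace ℝ (Fin (k n))} (hv : ∀ n j, ‖v n j‖ = D)
    {K : ℝ} {G : ℝ → ℝ} (hG : LinearlyLipschitz K G) :
    ∀ᵐ a ∂σ, Tendsto
      (fun n : ℕ+ => ⨆ j : Fin (d n), |(1 / ((n : ℕ) : ℝ)) * ∑ i, G (rowProj (v n j) (a n) i)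
        - ∫ x, G (D * x) ∂gaussianReal 0 1|) atTop (𝓝 0) := by
  set m := ∫ x, G (D * x) ∂gaussianReal 0 1 with hm
  have key : ∀ p : ℕ, ∀ᵐ a ∂σ, ∀ᶠ n : ℕ+ in atTop,
      a ∉ {a : ∀ n : ℕ+, stiefel n (k n) | ∃ j : Fin (d n), 1 / ((p : ℝ) + 1) ≤
        |(1 / ((n : ℕ) : ℝ)) * ∑ i, G (rowProj (v n j) (a n) i) - m|} := by
    intro p
    obtain ⟨c, hc, hdev⟩ := exists_stiefelHaar_deviation_le hG D (ε := 1 / ((p : ℝ) + 1))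
      Nat.one_div_pos_of_nat
    refine ae_eventually_pnat_of_measure_le (A := 4) (half_pos hc) ?_
    filter_upwards [eventually_natCast_le_exp_of_limsup_log_eq_zero hd_pos hd (half_pos hc)]
      with n hn
    have hj : ∀ j : Fin (d n), σ {a | 1 / ((p : ℝ) + 1) ≤
        |(1 / ((n : ℕ) : ℝ)) * ∑ i, G (rowProj (v n j) (a n) i) - m|}
        ≤ ENNReal.ofReal (4 * Real.exp (-c * (n : ℕ))) := fun j => by
      -- This inequality holds for every set, so the deviation event need not be shown measurable.
      have h1 := Measure.le_map_apply (μ := σ) (f := fun a => a n)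
        (measurable_pi_apply n).aemeasurable {b : stiefel n (k n) | 1 / ((p : ℝ) + 1) ≤
          |(1 / ((n : ℕ) : ℝ)) * ∑ i, G (rowProj (v n j) b i) - m|}
      rw [hσ n] at h1
      refine h1.trans ?_
      rw [← ENNReal.ofReal_toReal (measure_ne_top (stiefelHaar (hk n)) _)]
      exact ENNReal.ofReal_le_ofReal (hdev n (k n) (hk n) n.pos (v n j) (hv n j))
    rw [Set.ofPred_exists]
    refine (measure_iUnion_le _).trans ?_
    rw [tsum_fintype]
    refine (Finset.sum_le_sum fun j _ => hj j).trans ?_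
    rw [Finset.sum_const, Finset.card_univ, Fintype.card_fin, nsmul_eq_mul,
      ← ENNReal.ofReal_natCast, ← ENNReal.ofReal_mul (Nat.cast_nonneg _)]
    refine ENNReal.ofReal_le_ofReal ?_
    calc (d n : ℝ) * (4 * Real.exp (-c * (n : ℕ)))
        ≤ Real.exp (c / 2 * (n : ℕ)) * (4 * Real.exp (-c * (n : ℕ))) := by gcongr
      _ = 4 * Real.exp (-(c / 2) * (n : ℕ)) := by
        rw [mul_left_comm, ← Real.exp_add]
        congr 2
        ring
  filter_upwards [ae_all_iff.2 key] with a ha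
  refine Metric.tendsto_nhds.2 fun ε hε => ?_
  obtain ⟨p, hp⟩ := exists_nat_one_div_lt hε
  filter_upwards [ha p] with n hn
  simp only [not_exists, not_le] at hn
  rw [Real.dist_0_eq_abs, abs_of_nonneg (Real.iSup_nonneg fun _ => abs_nonneg _)]
  exact (Real.iSup_le (fun j => (hn j).le) (by positivity)).trans_lt hp

theorem integral_rowEmpirical {n k : ℕ} (v : EuclideanSpace ℝ (Fin k)) (a : stiefel n k)
    (H : ℝ → ℝ) :
    ∫ t, H t ∂rowEmpirical v a = (1 / (n : ℝ)) * ∑ i, H (rowProj v a i) := by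
  rw [rowEmpirical, integral_smul_measure,
    integral_finsetSum_measure fun i _ => integrable_dirac (by simp)]
  simp

/-- The growth bound with `α = 1`, `β = 0` has exponent `2 - α = 1`, a linear bound on `∂₁Λ`. -/
theorem linearlyLipschitz_logMGF {Λ : ℝ → ℝ → EReal} {T : EReal} (hreg : RegularLogMGF Λ T)
    (hgrowth : GrowthLogMGF Λ T) {c : ℝ} (hc : (c : EReal) < T) :
    ∃ K, LinearlyLipschitz K fun t => (Λ t c).toReal := by
  obtain ⟨C, -, -, hC⟩ := hgrowth
  refine ⟨C c, linearlyLipschitz_of_abs_deriv_le (fun t => ?_) fun t => ?_⟩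
  · simpa [partialDeriv] using hreg.exists_partial₁ 0 0 (by norm_num) t c hc
  · simpa [partialDeriv] using hC 1 0 (by norm_num) t c hc

/-- The derivative grows only like `√(1 + |t|)`, which is at most `1 + |t|`. -/
theorem linearlyLipschitz_of_sq_deriv_le {H : ℝ → ℝ} {C : ℝ} (hH : Differentiable ℝ H)
    (h : ∀ t, |deriv H t| ^ 2 ≤ C * (1 + |t|)) : LinearlyLipschitz √C H := by
  refine linearlyLipschitz_of_abs_deriv_le hH fun t => ?_
  have hC : 0 ≤ C := by simpa using (sq_nonneg _).trans (h 0)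
  refine abs_le_of_sq_le_sq' ?_ (by positivity) |>.2
  rw [mul_pow, Real.sq_sqrt hC]
  refine (h t).trans (mul_le_mul_of_nonneg_left ?_ hC)
  nlinarith [abs_nonneg t]

theorem lemma3p5
    -- dimensions, and a measure on the product of Stiefel manifolds with Haar marginals
    (k : ℕ+ → ℕ) (hk_pos : ∀ n, 1 ≤ k n) (hk : ∀ n : ℕ+, k n ≤ (n : ℕ))
    (σ : Measure (∀ n : ℕ+, stiefel n (k n))) [IsProbabilityMeasure σ]
    (hσ : ∀ n : ℕ+, σ.map (fun a => a n) = stiefelHaar (hk n))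
    -- i.i.d. random variables satisfying the assumptions
    {Ω : Type*} [MeasurableSpace Ω] (P : Measure Ω) [IsProbabilityMeasure P]
    (X : ℕ+ → Ω → ℝ) (hX_meas : ∀ j, Measurable (X j)) (hX_indep : iIndepFun X P)
    (hX_ident : ∀ j, IdentDistrib (X j) (X 1) P P)
    (η : ℝ → ℝ) (hη_cont : Continuous η) (hη_nonneg : ∀ x, 0 ≤ η x)
    (hX_subG : CenteredSubGaussian P (X 1))
    (T : EReal) (hΛ_reg : RegularLogMGF (logMGF P (X 1) η) T)
    (hΛ_growth : GrowthLogMGF (logMGF P (X 1) η) T)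
    -- subexponentially many vectors of norm `D`
    (D : ℝ) (hD : 0 < D) (d : ℕ+ → ℕ) (hd_pos : ∀ n, 1 ≤ d n)
    (hd : limsup (fun n : ℕ+ => ((Real.log (d n) / (n : ℕ) : ℝ) : EReal)) atTop = 0)
    (v : ∀ n : ℕ+, Fin (d n) → EuclideanSpace ℝ (Fin (k n))) (hv : ∀ n j, ‖v n j‖ = D) :
    (∀ c : ℝ, (c : EReal) < T →
      Integrable (fun x => (logMGF P (X 1) η (D * x) c).toReal) (gaussianReal 0 1) ∧
      ∀ᵐ a ∂σ, Tendsto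
        (fun n : ℕ+ => ⨆ j : Fin (d n), |rowAverage (logMGF P (X 1) η) (v n j) (a n) c
          - ∫ x, (logMGF P (X 1) η (D * x) c).toReal ∂gaussianReal 0 1|)
        atTop (𝓝 0)) ∧
    (∀ (H : ℝ → ℝ) (C : ℝ), Differentiable ℝ H →
      (∀ t, |H t| ^ 2 ≤ C * (1 + t ^ 2)) → (∀ t, |deriv H t| ^ 2 ≤ C * (1 + |t|)) →
      Integrable (fun x => H (D * x)) (gaussianReal 0 1) ∧
      ∀ᵐ a ∂σ, Tendsto
        (fun n : ℕ+ => ⨆ j : Fin (d n), |∫ t, H t ∂rowEmpirical (v n j) (a n)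
          - ∫ x, H (D * x) ∂gaussianReal 0 1|)
        atTop (𝓝 0)) := by
  refine ⟨fun c hc => ?_, fun H C hH _ hH' => ?_⟩
  · obtain ⟨K, hG⟩ := linearlyLipschitz_logMGF hΛ_reg hΛ_growth hc
    refine ⟨hG.integrable_comp_mul D, ?_⟩
    simpa only [rowAverage] using ae_tendsto_iSup_deviation hk hσ hd_pos hd hv hG
  · have hG := linearlyLipschitz_of_sq_deriv_le hH hH'
    refine ⟨hG.integrable_comp_mul D, ?_⟩
    simpa only [integral_rowEmpirical] using
      ae_tendsto_iSup_deviation hk hσ hd_pos hd hv hG
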